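/- Let $n\ge 2$, and let $G_k^{(n)}$ ($k\ge 0$) be the Gegenbauer polynomials defined by $G_0^{(n)}(t)=1$, $G_1^{(n)}(t)=t$ and $$G_k^{(n)}(t)=\frac{(2k+n-4)\,t\,G_{k-1}^{(n)}(t)-(k-1)\,G_{k-2}^{(n)}(t)}{k+n-3}\qquad(k\ge2).$$ Let $f:[-1,1]\to\mathbb R$ be a function with $f(t)=\sum_{k=0}^\infty f_kG_k^{(n)}(t)$, where the series converges uniformly on $[-1,1]$. A finite set $P=\{p_1,\dots,p_m\}\subset\mathbb S^{n-1}$ of $m$ distinct points of the unit sphere of $\mathbb R^n$ is called an $f$-design if 1. $\sum_{i=1}^m\sum_{j=1}^m G_k^{(n)}(p_i\cdot p_j)=0$ for every $k>0$ with $f_k\neq0$, and 2. for all $i\ne j$ one has $p_i\cdot p_j\in[-1,1)$ and $f(p_i\cdot p_j)=0$. For real sequences $A=(a_1,\dots,a_N)$ and $B=(b_1,\dots,b_N)$ with non-decreasing rearrangements $a_{(1)}\le\dots\le a_{(N)}$ and $b_{(1)}\le\dots\le b_{(N)}$, write $A\vartriangleright B$ if $a_{(1)}+\dots+a_{(k)}\ge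 b_{(1)}+\dots+b_{(k)}$ for all $k=1,\dots,N$; call $A$ and $B$ incomparable if neither $A\vartriangleright B$ nor $B\vartriangleright A$. For a symmetric function $\rho:S\times S\to\mathbb R$ and $X=(x_1,\dots,x_m)\in S^m$, let $R_\rho(X)$ be the sequence of the values $\rho(x_i,x_j)$, $1\le i<j\le m$. Then $X$ is called an $M$-set in $S$ with respect to $\rho$ if for every $Y\in S^m$ either $R_\rho(X)\vartriangleright R_\rho(Y)$, or $R_\rho(X)$ and $R_\rho(Y)$ are incomparable. **Theorem.** If $f_k\ge0$ for all $k\ge 0$, then every $f$-design $P=\{p_1,\dots,p_m\}$ in $\mathbb S^{n-1}$ is an $M$-set in $\mathbb S^{n-1}$ with respect to $\rho(x,y)=-f(x\cdot y)$. -/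

import Mathlib

namespace SphericalFDesign

noncomputable section

/-- The unit sphere `S^{n-1}` in `ℝ^n`. -/
abbrev Sphere (n : ℕ) : Type := Metric.sphere (0 : EuclideanSpace ℝ (Fin n)) 1

/-- The inner product `x · y` of two points of the sphere. -/
def dot {n : ℕ} (x y : Sphere n) : ℝ :=
  inner ℝ (x : EuclideanSpace ℝ (Fin n)) (y : EuclideanSpace ℝ (Fin n))

/-- The Gegenbauer polynomial `G_k^{(n)}(t)` (for `n ≥ 2`), by the recurrence
`G_k = ((2k+n-4) t G_{k-1} - (k-1) G_{k-2}) / (k+n-3)` for `k ≥ 2`, written here with `k+2`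
in place of `k`. -/
def gegenbauer (n : ℕ) : ℕ → ℝ → ℝ
  | 0, _ => 1
  | 1, t => t
  | k + 2, t =>
      ((2 * (k : ℝ) + (n : ℝ)) * t * gegenbauer n (k + 1) t
        - ((k : ℝ) + 1) * gegenbauer n k t) / ((k : ℝ) + (n : ℝ) - 1)

/-- The series `∑ c k * G_k^{(n)}` converges uniformly to `f` on `[-1, 1]`. -/
def HasGegenbauerSeries (n : ℕ) (f : ℝ → ℝ) (c : ℕ → ℝ) : Prop :=
  TendstoUniformlyOn (fun (N : ℕ) (t : ℝ) => ∑ k ∈ Finset.range N, c k * gegenbauer n k t) f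
    Filter.atTop (Set.Icc (-1 : ℝ) 1)

/-- The `k`-th moment `M_k(P)`: the sum over all ordered pairs, equal points included. -/
def moment {n : ℕ} (k : ℕ) (P : Finset (Sphere n)) : ℝ :=
  ∑ p ∈ P, ∑ q ∈ P, gegenbauer n k (dot p q)

/-- The set `D(P)` of inner products of distinct points of `P`. -/
def innerProducts {n : ℕ} (P : Finset (Sphere n)) : Set ℝ :=
  {t | ∃ p ∈ P, ∃ q ∈ P, p ≠ q ∧ dot p q = t}

/-- The set `Z_f` of zeros of `f` in `[-1, 1)`. -/
def zeroSet (f : ℝ → ℝ) : Set ℝ := {t | t ∈ Set.Ico (-1 : ℝ) 1 ∧ f t = 0}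

/-- `P` is an `f`-design, where `f = ∑ c k * G_k^{(n)}`. -/
def IsFDesign {n : ℕ} (f : ℝ → ℝ) (c : ℕ → ℝ) (P : Finset (Sphere n)) : Prop :=
  (∀ k : ℕ, 0 < k → c k ≠ 0 → moment k P = 0) ∧ innerProducts P ⊆ zeroSet f

/-- The sum of the `k` smallest entries of a finite sequence, taken up to order. -/
def sumSmallest (A : Multiset ℝ) (k : ℕ) : ℝ := ((A.sort (· ≤ ·)).take k).sum

/-- `A` majorizes `B`, for two sequences of the same length taken up to order: for every `k`
from `1` to the length, the sum of the `k` smallest entries of `A` is at least that of `B`. -/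
def Majorizes (A B : Multiset ℝ) : Prop :=
  A.card = B.card ∧ ∀ k : ℕ, 1 ≤ k → k ≤ A.card → sumSmallest B k ≤ sumSmallest A k

/-- `R_ρ(x)`: the values `ρ (x i) (x j)` for `i < j`, with multiplicity. -/
def pairValues {S : Type*} {m : ℕ} (ρ : S → S → ℝ) (x : Fin m → S) : Multiset ℝ :=
  ((Finset.univ : Finset (Fin m × Fin m)).filter (fun p => p.1 < p.2)).val.map
    (fun p => ρ (x p.1) (x p.2))

/-- Neither sequence majorizes the other. -/
def Incomparable (A B : Multiset ℝ) : Prop := ¬ Majorizes A B ∧ ¬ Majorizes B A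

/-- `x ∈ S^m` is an `M`-set in `S` with respect to `ρ`: for every `y ∈ S^m`, either `R_ρ(x)`
majorizes `R_ρ(y)`, or the two are incomparable. -/
def IsMTuple {S : Type*} {m : ℕ} (ρ : S → S → ℝ) (x : Fin m → S) : Prop :=
  ∀ y : Fin m → S,
    Majorizes (pairValues ρ x) (pairValues ρ y) ∨
      Incomparable (pairValues ρ x) (pairValues ρ y)

/-- `M(S, ρ, m)`: the `M`-sets of cardinality `m`, that is, the `m`-subsets `{x_1, …, x_m}` of
`S` such that `(x_1, …, x_m)` is an `M`-set; for symmetric `ρ` the numbering is irrelevant. -/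
def mSets (S : Type*) (ρ : S → S → ℝ) (m : ℕ) : Set (Finset S) :=
  {X | X.card = m ∧ ∀ x : Fin m ≃ {p : S // p ∈ X}, IsMTuple ρ (fun i => (x i : S))}

end

end SphericalFDesign

/-!
For unit vectors `x`, the Gegenbauer polynomial `G_k(x · y)` is the restriction to the sphere of a
harmonic homogeneous polynomial `Z_x` in `y`. Modulo `∑ X i ^ 2`, which is adjoint to the Laplacian
for the Fischer form, `Z_x` is a multiple of `(x · y) ^ k`, and `⟨(x · y) ^ k, q⟩ = k! q(x)` for `q`
homogeneous of degree `k`; so `G_k(x · y)` is a positive multiple of `⟨Z_x, Z_y⟩`, a positive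
semidefinite kernel (Schoenberg). Therefore `∑ f(y_i · y_j) ≥ c₀ m²` for all `m` points of the
sphere, with equality for an `f`-design: its off-diagonal sum of `f` is the least possible.

The off-diagonal values of `f` on a design all vanish, so the off-diagonal values of `-f` on any
other `m` points have a nonpositive sum. The average of the `k` smallest terms of a sequence is at
most the average of all its terms, so a constant sequence majorizes every sequence of the same
length whose sum is not larger.
-/

namespace SphericalFDesign

section Harmonic

open MvPolynomial

section Fischer

/-- The Fischer form `⟨p, q⟩ = ∑ α! p_α q_α`, for which multiplication by `X i` is adjoint to
`∂ i`. -/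
noncomputable def fischer (σ R : Type*) [CommSemiring R] :
    LinearMap.BilinForm R (MvPolynomial σ R) :=
  (basisMonomials σ R).constr R fun α => (α.prod fun _ a => (a.factorial : R)) • lcoeff R α

variable {σ R : Type*}

section CommSemiring

variable [CommSemiring R]

lemma fischer_monomial (α : σ →₀ ℕ) (a : R) (q : MvPolynomial σ R) :
    fischer σ R (monomial α a) q = a * ((α.prod fun _ a => (a.factorial : R)) * coeff α q) := by
  have hbasis : monomial α a = a • basisMonomials σ R α := by
    rw [coe_basisMonomials, smul_monomial, smul_eq_mul, mul_one]
  rw [hbasis, map_smul, fischer, Module.Basis.constr_basis]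
  rfl

lemma prod_factorial_add_single (α : σ →₀ ℕ) (i : σ) :
    ((α + Finsupp.single i 1).prod fun _ a => (a.factorial : R))
      = (α i + 1) * α.prod fun _ a => (a.factorial : R) := by
  classical
  rw [← Finsupp.mul_prod_erase' _ i _ (by simp), ← Finsupp.mul_prod_erase' α i _ (by simp)]
  simp [Finsupp.erase_add, Nat.factorial_succ, mul_assoc]

lemma fischer_X_mul (i : σ) (p q : MvPolynomial σ R) :
    fischer σ R (X i * p) q = fischer σ R p (pderiv i q) := by
  induction p using MvPolynomial.induction_on' with
  | monomial α a =>
    rw [X, monomial_mul, fischer_monomial, fischer_monomial, coeff_pderiv, one_mul,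
      add_comm (Finsupp.single i 1), prod_factorial_add_single]
    ring
  | add p q hp hq =>
    rw [mul_add, map_add, map_add, LinearMap.add_apply, LinearMap.add_apply, hp, hq]

lemma fischer_isSymm : (fischer σ R).IsSymm := by
  classical
  refine (LinearMap.BilinForm.isSymm_iff_basis (basisMonomials σ R)).2 fun α β => ?_
  rw [coe_basisMonomials, fischer_monomial, fischer_monomial, coeff_monomial, coeff_monomial]
  rcases eq_or_ne α β with rfl | h
  · rfl
  · simp [h, h.symm]

lemma fischer_apply_self (p : MvPolynomial σ R) :
    fischer σ R p p
      = ∑ α ∈ p.support, (α.prod fun _ a => (a.factorial : R)) * (coeff α p * coeff α p) := by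
  conv_lhs => enter [1]; rw [p.as_sum]
  rw [map_sum, LinearMap.sum_apply]
  exact Finset.sum_congr rfl fun α _ => by rw [fischer_monomial, mul_left_comm]

end CommSemiring

lemma fischer_isPosSemidef [CommRing R] [LinearOrder R] [IsOrderedRing R] :
    (fischer σ R).IsPosSemidef where
  eq := fischer_isSymm.eq
  nonneg p := by
    rw [fischer_apply_self]
    exact Finset.sum_nonneg fun α _ =>
      mul_nonneg (Finset.prod_nonneg fun _ _ => Nat.cast_nonneg _) (mul_self_nonneg _)

end Fischer

lemma posSemidef_of_isPosSemidef {ι R M : Type*} [CommRing R] [PartialOrder R] [StarRing R]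
    [TrivialStar R] [AddCommGroup M] [Module R M] {B : LinearMap.BilinForm R M}
    (hB : B.IsPosSemidef) (v : ι → M) : (Matrix.of fun i j => B (v i) (v j)).PosSemidef := by
  refine ⟨Matrix.IsHermitian.ext fun i j => ?_, fun a => ?_⟩
  · simpa using hB.isSymm.eq (v j) (v i)
  · convert hB.nonneg (a.sum fun i r => r • v i) using 1
    simp only [Finsupp.sum, map_sum, map_smul, LinearMap.sum_apply, LinearMap.smul_apply,
      smul_eq_mul, star_trivial, Matrix.of_apply, Finset.mul_sum]
    rw [Finset.sum_comm]
    exact Finset.sum_congr rfl fun j _ => Finset.sum_congr rfl fun i _ => by ring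

section Directional

variable {σ R : Type*}

variable [Fintype σ] [CommSemiring R]

/-- The linear form `y ↦ x · y`, as a polynomial. -/
noncomputable def linForm (x : σ → R) : MvPolynomial σ R := ∑ i, x i • X i

/-- The directional derivative `∑ x_i ∂_i` on polynomials. -/
noncomputable def dirDeriv (x : σ → R) : Derivation R (MvPolynomial σ R) (MvPolynomial σ R) :=
  ∑ i, x i • pderiv i

/-- The Laplacian `∑ ∂_i²` on polynomials. -/
noncomputable def laplacian (σ R : Type*) [Fintype σ] [CommSemiring R] :
    MvPolynomial σ R →ₗ[R] MvPolynomial σ R :=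
  ∑ i, (pderiv i).toLinearMap ∘ₗ (pderiv i).toLinearMap

lemma dirDeriv_apply (x : σ → R) (p : MvPolynomial σ R) :
    dirDeriv x p = ∑ i, x i • pderiv i p :=
  (congrFun (map_sum Derivation.coeFnAddMonoidHom (fun i => x i • pderiv i) Finset.univ) p).trans
    (Finset.sum_apply _ _ _)

lemma laplacian_apply (p : MvPolynomial σ R) : laplacian σ R p = ∑ i, pderiv i (pderiv i p) := by
  simp [laplacian]

lemma pderiv_linForm (x : σ → R) (i : σ) : pderiv i (linForm x) = C (x i) := by
  classical
  simp [linForm, pderiv_X, Pi.single_apply, smul_eq_C_mul]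

lemma pderiv_psum_two (i : σ) : pderiv i (psum σ R 2) = 2 * X i := by
  classical
  simp [psum, pderiv_X, Pi.single_apply]

lemma dirDeriv_linForm (x y : σ → R) : dirDeriv x (linForm y) = C (x ⬝ᵥ y) := by
  simp [dirDeriv_apply, pderiv_linForm, dotProduct, smul_eq_C_mul]

lemma dirDeriv_psum_two (x : σ → R) : dirDeriv x (psum σ R 2) = 2 * linForm x := by
  simp [dirDeriv_apply, pderiv_psum_two, linForm, Finset.mul_sum]

lemma laplacian_mul (p q : MvPolynomial σ R) :
    laplacian σ R (p * q)
      = p * laplacian σ R q + 2 * ∑ i, pderiv i p * pderiv i q + laplacian σ R p * q := by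
  simp only [laplacian_apply, Finset.mul_sum, Finset.sum_mul, ← Finset.sum_add_distrib, pderiv_mul,
    map_add]
  exact Finset.sum_congr rfl fun i _ => by ring

lemma laplacian_linForm_mul (x : σ → R) (p : MvPolynomial σ R) :
    laplacian σ R (linForm x * p) = linForm x * laplacian σ R p + 2 * dirDeriv x p := by
  have hharm : laplacian σ R (linForm x) = 0 := by simp [laplacian_apply, pderiv_linForm]
  simp [laplacian_mul, hharm, pderiv_linForm, dirDeriv_apply, smul_eq_C_mul]

lemma laplacian_psum_two : laplacian σ R (psum σ R 2) = 2 * Fintype.card σ := by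
  have hconst : ∀ i : σ, pderiv i (2 : MvPolynomial σ R) = 0 := fun i => by
    rw [← map_ofNat C 2, pderiv_C]
  simp [laplacian_apply, pderiv_psum_two, hconst, mul_comm]

lemma laplacian_psum_two_mul {k : ℕ} {p : MvPolynomial σ R} (hp : p.IsHomogeneous k) :
    laplacian σ R (psum σ R 2 * p)
      = psum σ R 2 * laplacian σ R p + (4 * k + 2 * Fintype.card σ) * p := by
  have heuler : ∑ i, pderiv i (psum σ R 2) * pderiv i p = 2 * (k * p) := by
    simp only [pderiv_psum_two, mul_assoc, ← Finset.mul_sum, hp.sum_X_mul_pderiv, nsmul_eq_mul]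
  rw [laplacian_mul, heuler, laplacian_psum_two]
  ring

lemma isHomogeneous_linForm (x : σ → R) : (linForm x).IsHomogeneous 1 :=
  IsHomogeneous.sum _ _ _ fun i _ => by
    rw [smul_eq_C_mul]
    exact isHomogeneous_C_mul_X _ i

lemma isHomogeneous_psum (k : ℕ) : (psum σ R k).IsHomogeneous k :=
  IsHomogeneous.sum _ _ _ fun i _ => isHomogeneous_X_pow i k

lemma isHomogeneous_dirDeriv {k : ℕ} (x : σ → R) {p : MvPolynomial σ R}
    (hp : p.IsHomogeneous (k + 1)) : (dirDeriv x p).IsHomogeneous k := by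
  rw [dirDeriv_apply]
  refine IsHomogeneous.sum _ _ _ fun i _ => ?_
  rw [smul_eq_C_mul]
  exact hp.pderiv.C_mul _

lemma eval_dirDeriv_self {k : ℕ} (x : σ → R) {p : MvPolynomial σ R} (hp : p.IsHomogeneous k) :
    eval x (dirDeriv x p) = k * eval x p := by
  simpa [dirDeriv_apply, smul_eval] using congrArg (eval x) hp.sum_X_mul_pderiv

lemma fischer_linForm_mul (x : σ → R) (p q : MvPolynomial σ R) :
    fischer σ R (linForm x * p) q = fischer σ R p (dirDeriv x q) := by
  simp [linForm, dirDeriv_apply, Finset.sum_mul, fischer_X_mul]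

lemma fischer_psum_two_mul (p q : MvPolynomial σ R) :
    fischer σ R (psum σ R 2 * p) q = fischer σ R p (laplacian σ R q) := by
  simp [psum, laplacian_apply, Finset.sum_mul, pow_two, mul_assoc, fischer_X_mul]

lemma fischer_linForm_pow (x : σ → R) {k : ℕ} {q : MvPolynomial σ R} (hq : q.IsHomogeneous k) :
    fischer σ R (linForm x ^ k) q = k.factorial * eval x q := by
  induction k generalizing q with
  | zero =>
    rw [totalDegree_eq_zero_iff_eq_C.1 ((totalDegree_zero_iff_isHomogeneous _).2 hq), pow_zero,
      ← C_1, C_apply, fischer_monomial]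
    simp
  | succ k ih =>
    rw [pow_succ', fischer_linForm_mul, ih (isHomogeneous_dirDeriv x hq), eval_dirDeriv_self x hq,
      Nat.factorial_succ]
    push_cast
    ring

end Directional

section Zonal

variable {σ : Type*} [Fintype σ]

/-- The zonal polynomial of degree `k` with pole `x`: the homogenization of
`y ↦ gegenbauer (card σ) k (x · y)` by powers of `∑ X i ^ 2`. -/
noncomputable def zonal (x : σ → ℝ) : ℕ → MvPolynomial σ ℝ
  | 0 => 1
  | 1 => linForm x
  | k + 2 => ((k : ℝ) + Fintype.card σ - 1)⁻¹ •
      ((2 * (k : ℝ) + Fintype.card σ) • (linForm x * zonal x (k + 1))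
        - ((k : ℝ) + 1) • (psum σ ℝ 2 * zonal x k))

/-- The coefficient of `t ^ k` in the Gegenbauer polynomial `gegenbauer n k`. -/
noncomputable def gegenbauerLeadingCoeff (n : ℕ) : ℕ → ℝ
  | 0 => 1
  | 1 => 1
  | k + 2 => ((k : ℝ) + n - 1)⁻¹ * ((2 * (k : ℝ) + n) * gegenbauerLeadingCoeff n (k + 1))

lemma gegenbauer_denom_pos {n : ℕ} (hn : 1 < n) (k : ℕ) : 0 < (k : ℝ) + n - 1 := by
  have hn' : (1 : ℝ) < n := by exact_mod_cast hn
  linarith [(Nat.cast_nonneg k : (0 : ℝ) ≤ k)]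

lemma gegenbauerLeadingCoeff_pos {n : ℕ} (hn : 1 < n) (k : ℕ) :
    0 < gegenbauerLeadingCoeff n k := by
  induction k using Nat.twoStepInduction with
  | zero => exact one_pos
  | one => exact one_pos
  | more k _ hk =>
    have hdenom := gegenbauer_denom_pos hn k
    rw [gegenbauerLeadingCoeff]
    positivity

lemma isHomogeneous_zonal (x : σ → ℝ) (k : ℕ) : (zonal x k).IsHomogeneous k := by
  induction k using Nat.twoStepInduction with
  | zero => exact isHomogeneous_one _ _
  | one => exact isHomogeneous_linForm x
  | more k h₀ h₁ =>
    have hlin : (linForm x * zonal x (k + 1)).IsHomogeneous (k + 2) := by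
      simpa [add_comm, add_left_comm] using (isHomogeneous_linForm x).mul h₁
    have hsq : (psum σ ℝ 2 * zonal x k).IsHomogeneous (k + 2) := by
      simpa [add_comm] using (isHomogeneous_psum 2).mul h₀
    rw [zonal]
    simp only [← mem_homogeneousSubmodule] at hlin hsq ⊢
    exact Submodule.smul_mem _ _
      (Submodule.sub_mem _ (Submodule.smul_mem _ _ hlin) (Submodule.smul_mem _ _ hsq))

lemma eval_zonal (x : σ → ℝ) {y : σ → ℝ} (hy : y ⬝ᵥ y = 1) (k : ℕ) :
    eval y (zonal x k) = gegenbauer (Fintype.card σ) k (x ⬝ᵥ y) := by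
  have hlin : eval y (linForm x) = x ⬝ᵥ y := by simp [linForm, dotProduct, smul_eval]
  have hsq : eval y (psum σ ℝ 2) = 1 := by simpa [psum, dotProduct, pow_two] using hy
  induction k using Nat.twoStepInduction with
  | zero => simp [zonal, gegenbauer]
  | one => simp [zonal, gegenbauer, hlin]
  | more k h₀ h₁ =>
    simp only [zonal, gegenbauer, smul_eval, map_sub, map_mul, h₀, h₁, hlin, hsq]
    ring

lemma psum_two_dvd_zonal_sub (x : σ → ℝ) (k : ℕ) :
    psum σ ℝ 2 ∣ zonal x k - gegenbauerLeadingCoeff (Fintype.card σ) k • linForm x ^ k := by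
  induction k using Nat.twoStepInduction with
  | zero => simp [zonal, gegenbauerLeadingCoeff]
  | one => simp [zonal, gegenbauerLeadingCoeff]
  | more k _ h =>
    obtain ⟨r, hr⟩ := h
    rw [sub_eq_iff_eq_add] at hr
    refine ⟨((k : ℝ) + Fintype.card σ - 1)⁻¹ •
      ((2 * (k : ℝ) + Fintype.card σ) • (linForm x * r) - ((k : ℝ) + 1) • zonal x k), ?_⟩
    rw [zonal, gegenbauerLeadingCoeff, hr]
    simp only [smul_eq_C_mul, map_mul]
    ring

lemma fischer_zonal (x : σ → ℝ) {k : ℕ} {q : MvPolynomial σ ℝ} (hq : q.IsHomogeneous k)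
    (hharm : laplacian σ ℝ q = 0) :
    fischer σ ℝ (zonal x k) q
      = gegenbauerLeadingCoeff (Fintype.card σ) k * k.factorial * eval x q := by
  obtain ⟨r, hr⟩ := psum_two_dvd_zonal_sub x k
  rw [sub_eq_iff_eq_add] at hr
  rw [hr, map_add, LinearMap.add_apply, fischer_psum_two_mul, hharm, map_zero, zero_add, map_smul,
    LinearMap.smul_apply, fischer_linForm_pow x hq, smul_eq_mul, mul_assoc]

section Nontrivial

variable [Nontrivial σ]

lemma zonal_add_two (x : σ → ℝ) (k : ℕ) :
    ((k : ℝ) + Fintype.card σ - 1) • zonal x (k + 2)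
      = (2 * (k : ℝ) + Fintype.card σ) • (linForm x * zonal x (k + 1))
        - ((k : ℝ) + 1) • (psum σ ℝ 2 * zonal x k) := by
  rw [zonal, smul_inv_smul₀ (gegenbauer_denom_pos Fintype.one_lt_card k).ne']

/-- At `k = 0` the truncated `zonal x (0 - 1)` has coefficient `0`. -/
lemma zonal_add_one (x : σ → ℝ) (k : ℕ) :
    ((k : ℝ) + Fintype.card σ - 2) • zonal x (k + 1)
      = (2 * (k : ℝ) + Fintype.card σ - 2) • (linForm x * zonal x k)
        - (k : ℝ) • (psum σ ℝ 2 * zonal x (k - 1)) := by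
  cases k with
  | zero => simp [zonal]
  | succ k =>
    convert zonal_add_two x k using 2
    · push_cast
      ring
    · congr 1
      push_cast
      ring
    · rw [Nat.cast_add_one, Nat.add_sub_cancel]

lemma dirDeriv_zonal {x : σ → ℝ} (hx : x ⬝ᵥ x = 1) (k : ℕ) :
    dirDeriv x (zonal x k) = (k : ℝ) • zonal x (k - 1) := by
  induction k using Nat.twoStepInduction with
  | zero => simp [zonal]
  | one => simp [zonal, dirDeriv_linForm, hx]
  | more k h₀ h₁ =>
    have hdenom := (gegenbauer_denom_pos (Fintype.one_lt_card (α := σ)) k).ne'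
    have hrec := congrArg (dirDeriv x) (zonal_add_two x k)
    simp only [Derivation.map_smul, map_sub, Derivation.leibniz, smul_eq_mul, dirDeriv_linForm,
      dirDeriv_psum_two, hx, h₀, h₁, map_one, mul_one, Nat.add_sub_cancel] at hrec
    have hprev := zonal_add_one x k
    rw [show k + 2 - 1 = k + 1 from rfl]
    refine smul_right_injective _ hdenom ?_
    simp only [smul_eq_C_mul, map_add, map_sub, map_mul, map_one, map_natCast, map_ofNat,
      Nat.cast_add, Nat.cast_one, Nat.cast_ofNat] at hrec hprev ⊢
    linear_combination hrec - ((k : MvPolynomial σ ℝ) + 1) * hprev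

lemma laplacian_zonal {x : σ → ℝ} (hx : x ⬝ᵥ x = 1) (k : ℕ) :
    laplacian σ ℝ (zonal x k) = 0 := by
  induction k using Nat.twoStepInduction with
  | zero => simp [zonal, laplacian_apply]
  | one => simp [zonal, laplacian_apply, pderiv_linForm]
  | more k h₀ h₁ =>
    rw [zonal, map_smul, map_sub, map_smul, map_smul, laplacian_linForm_mul,
      laplacian_psum_two_mul (isHomogeneous_zonal x k), h₀, h₁, dirDeriv_zonal hx]
    simp only [smul_eq_C_mul, map_add, map_mul, map_one, map_natCast, map_ofNat,
      Nat.add_sub_cancel, Nat.cast_add, Nat.cast_one]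
    ring

theorem posSemidef_gegenbauer_dotProduct {ι : Type*} {v : ι → σ → ℝ}
    (hv : ∀ i, v i ⬝ᵥ v i = 1) (k : ℕ) :
    (Matrix.of fun i j => gegenbauer (Fintype.card σ) k (v i ⬝ᵥ v j)).PosSemidef := by
  set γ := gegenbauerLeadingCoeff (Fintype.card σ) k * k.factorial
  have hγ : 0 < γ :=
    mul_pos (gegenbauerLeadingCoeff_pos Fintype.one_lt_card k) (Nat.cast_pos.2 k.factorial_pos)
  have hrepr (i j : ι) : fischer σ ℝ (zonal (v i) k) (zonal (v j) k)
      = γ * gegenbauer (Fintype.card σ) k (v i ⬝ᵥ v j) := by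
    rw [fischer_zonal _ (isHomogeneous_zonal _ k) (laplacian_zonal (hv j) k),
      eval_zonal _ (hv i), dotProduct_comm]
  have hgram := (posSemidef_of_isPosSemidef fischer_isPosSemidef fun i => zonal (v i) k).smul
    (inv_nonneg.2 hγ.le)
  simpa only [hrepr, Matrix.smul_of, Pi.smul_def, smul_eq_mul, inv_mul_cancel_left₀ hγ.ne']
    using hgram

end Nontrivial

end Zonal

end Harmonic

section Majorization

lemma length_nsmul_sum_le_length_nsmul_sum {M : Type*} [AddCommMonoid M] [Preorder M]
    [AddLeftMono M] [AddRightMono M] {l₁ l₂ : List M} (h : ∀ a ∈ l₁, ∀ b ∈ l₂, a ≤ b) :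
    l₂.length • l₁.sum ≤ l₁.length • l₂.sum := by
  have hle : ∀ b ∈ l₂, l₁.sum ≤ l₁.length • b := fun b hb =>
    List.sum_le_card_nsmul l₁ b fun a ha => h a ha b hb
  simpa [List.smul_sum] using List.card_nsmul_le_sum (l₂.map (l₁.length • ·)) l₁.sum
    (by simpa using hle)

lemma card_mul_sumSmallest_le (A : Multiset ℝ) {k : ℕ} (hk : k ≤ A.card) :
    A.card * sumSmallest A k ≤ k * A.sum := by
  set l := A.sort (· ≤ ·) with hl
  have hlen : l.length = A.card := A.length_sort (· ≤ ·)
  have hsum : (l.take k).sum + (l.drop k).sum = A.sum := by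
    rw [List.sum_take_add_sum_drop, ← Multiset.sum_coe, Multiset.sort_eq]
  have hsorted : ∀ a ∈ l.take k, ∀ b ∈ l.drop k, a ≤ b := by
    have hpw := A.pairwise_sort (· ≤ ·)
    rw [← hl, ← List.take_append_drop k l, List.pairwise_append] at hpw
    exact hpw.2.2
  have havg := length_nsmul_sum_le_length_nsmul_sum hsorted
  rw [List.length_drop, List.length_take, hlen, min_eq_left hk, nsmul_eq_mul, nsmul_eq_mul,
    Nat.cast_sub hk] at havg
  rw [sumSmallest, ← hl, ← hsum]
  linarith

lemma sumSmallest_replicate (a : ℝ) {k N : ℕ} (hk : k ≤ N) :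
    sumSmallest (Multiset.replicate N a) k = k * a := by
  have hsort : (Multiset.replicate N a).sort (· ≤ ·) = List.replicate N a :=
    List.eq_replicate_iff.2 ⟨by rw [Multiset.length_sort, Multiset.card_replicate],
      fun b hb => Multiset.eq_of_mem_replicate ((Multiset.mem_sort _).1 hb)⟩
  rw [sumSmallest, hsort, List.take_replicate, List.sum_replicate, min_eq_left hk, nsmul_eq_mul]

lemma majorizes_replicate {A : Multiset ℝ} {a : ℝ} (hA : A.sum ≤ A.card * a) :
    Majorizes (Multiset.replicate A.card a) A := by
  refine ⟨Multiset.card_replicate _ _, fun k hk hkN => ?_⟩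
  rw [Multiset.card_replicate] at hkN
  have hcard : (0 : ℝ) < A.card := Nat.cast_pos.2 (hk.trans hkN)
  rw [sumSmallest_replicate a hkN]
  refine le_of_mul_le_mul_left ?_ hcard
  calc A.card * sumSmallest A k ≤ k * A.sum := card_mul_sumSmallest_le A hkN
    _ ≤ k * (A.card * a) := by gcongr
    _ = A.card * (k * a) := by ring

end Majorization

section Energy

variable {S ι : Type*} [Fintype ι]

/-- The energy of a configuration `x` for the pair potential `K`, with every ordered pair counted,
including the self-energies `K (x i) (x i)`. -/
def energy (K : S → S → ℝ) (x : ι → S) : ℝ := ∑ i, ∑ j, K (x i) (x j)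

lemma energy_nonneg_of_posSemidef {K : S → S → ℝ} (hK : (Matrix.of K).PosSemidef) (x : ι → S) :
    0 ≤ energy K x := by
  simpa [energy, dotProduct, Matrix.mulVec] using (hK.submatrix x).dotProduct_mulVec_nonneg 1

lemma sum_pairValues {m : ℕ} (ρ : S → S → ℝ) (x : Fin m → S) :
    (pairValues ρ x).sum = ∑ i, ∑ j ∈ Finset.Ioi i, ρ (x i) (x j) := by
  change ∑ p : Fin m × Fin m with p.1 < p.2, ρ (x p.1) (x p.2) = _
  simp only [Finset.sum_filter, Fintype.sum_prod_type, ← Finset.filter_lt_eq_Ioi]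

lemma card_pairValues_congr {m : ℕ} (ρ : S → S → ℝ) (x y : Fin m → S) :
    (pairValues ρ x).card = (pairValues ρ y).card := by
  simp only [pairValues, Multiset.card_map]

lemma energy_eq_sum_diag_add_two_mul {m : ℕ} {K : S → S → ℝ} (hK : ∀ a b, K a b = K b a)
    (x : Fin m → S) :
    energy K x = ∑ i, K (x i) (x i) + 2 * (pairValues K x).sum := by
  have hoff := Finset.sum_sum_Ioi_add_eq_sum_sum_off_diag fun i j => K (x i) (x j)
  calc energy K x = ∑ i, (K (x i) (x i) + ∑ j ∈ {i}ᶜ, K (x j) (x i)) :=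
        Finset.sum_congr rfl fun i _ => by
          rw [Fintype.sum_eq_add_sum_compl i]
          simp only [hK (x i)]
    _ = ∑ i, K (x i) (x i) + 2 * (pairValues K x).sum := by
        rw [Finset.sum_add_distrib, ← hoff, sum_pairValues, Finset.mul_sum]
        simp only [Finset.mul_sum, two_mul, hK]

open Filter Topology in
lemma tendsto_sum_mul_energy {c : ℕ → ℝ} {K : ℕ → S → S → ℝ} {L : S → S → ℝ}
    (hL : ∀ p q, Tendsto (fun N => ∑ k ∈ Finset.range N, c k * K k p q) atTop (𝓝 (L p q)))
    (x : ι → S) :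
    Tendsto (fun N => ∑ k ∈ Finset.range N, c k * energy (K k) x) atTop (𝓝 (energy L x)) := by
  have h := tendsto_finsetSum Finset.univ fun i _ => tendsto_finsetSum Finset.univ fun j _ =>
    hL (x i) (x j)
  refine h.congr fun N => ?_
  simp only [energy, Finset.mul_sum]
  rw [Finset.sum_comm (s := Finset.range N)]
  exact Finset.sum_congr rfl fun i _ => Finset.sum_comm

lemma energy_comp_equiv {κ : Type*} [Fintype κ] (K : S → S → ℝ) (e : κ ≃ ι) (x : ι → S) :
    energy K (x ∘ e) = energy K x := by
  rw [energy, energy, ← e.sum_comp]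
  exact Finset.sum_congr rfl fun i _ => e.sum_comp fun j => K (x (e i)) (x j)

lemma moment_eq_energy {n : ℕ} (k : ℕ) (P : Finset (Sphere n)) :
    moment k P = energy (fun p q => gegenbauer n k (dot p q)) ((↑) : P → Sphere n) := by
  simp only [moment, energy, ← Finset.sum_coe_sort P]

end Energy

section Spherical

open Filter Topology

variable {n : ℕ}

lemma dot_eq_dotProduct (x y : Sphere n) : dot x y = x.1.ofLp ⬝ᵥ y.1.ofLp := by
  simp [dot, PiLp.inner_apply, dotProduct, mul_comm]

lemma dot_self (x : Sphere n) : dot x x = 1 := by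
  rw [dot, real_inner_self_eq_norm_sq, norm_eq_of_mem_sphere, one_pow]

lemma dot_comm (x y : Sphere n) : dot x y = dot y x :=
  real_inner_comm _ _

lemma dot_mem_Icc (x y : Sphere n) : dot x y ∈ Set.Icc (-1 : ℝ) 1 := by
  have h := abs_real_inner_le_norm (x : EuclideanSpace ℝ (Fin n)) y
  rw [norm_eq_of_mem_sphere, norm_eq_of_mem_sphere, one_mul] at h
  exact abs_le.1 h

lemma posSemidef_gegenbauer_dot (hn : 2 ≤ n) (k : ℕ) :
    (Matrix.of fun x y : Sphere n => gegenbauer n k (dot x y)).PosSemidef := by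
  have : Nontrivial (Fin n) := Fin.nontrivial_iff_two_le.2 hn
  have h := posSemidef_gegenbauer_dotProduct (v := fun x : Sphere n => x.1.ofLp)
    (fun x => by rw [← dot_eq_dotProduct, dot_self]) k
  simpa only [dot_eq_dotProduct, Fintype.card_fin] using h

variable {f : ℝ → ℝ} {c : ℕ → ℝ} {ι : Type*} [Fintype ι]

lemma energy_gegenbauer_zero (y : ι → Sphere n) :
    energy (fun p q => gegenbauer n 0 (dot p q)) y = (Fintype.card ι : ℝ) ^ 2 := by
  simp [energy, gegenbauer, pow_two]

lemma mul_card_sq_le_energy (hn : 2 ≤ n)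
    (hf : ∀ t ∈ Set.Icc (-1 : ℝ) 1,
      Tendsto (fun N => ∑ k ∈ Finset.range N, c k * gegenbauer n k t) atTop (𝓝 (f t)))
    (hc : ∀ k, 0 < k → 0 ≤ c k) (y : ι → Sphere n) :
    c 0 * (Fintype.card ι : ℝ) ^ 2 ≤ energy (fun p q => f (dot p q)) y := by
  refine ge_of_tendsto (tendsto_sum_mul_energy (fun p q => hf _ (dot_mem_Icc p q)) y) ?_
  filter_upwards [eventually_ge_atTop 1] with N hN
  obtain ⟨N, rfl⟩ := Nat.exists_eq_add_of_le' hN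
  rw [Finset.sum_range_succ', energy_gegenbauer_zero]
  exact le_add_of_nonneg_left <| Finset.sum_nonneg fun k _ => mul_nonneg (hc _ k.succ_pos)
    (energy_nonneg_of_posSemidef (posSemidef_gegenbauer_dot hn _) y)

lemma energy_dot (f : ℝ → ℝ) {m : ℕ} (y : Fin m → Sphere n) :
    energy (fun p q => f (dot p q)) y
      = m * f 1 - 2 * (pairValues (fun p q => -f (dot p q)) y).sum := by
  rw [energy_eq_sum_diag_add_two_mul (fun p q => by rw [dot_comm])]
  simp [sum_pairValues, dot_self]

namespace IsFDesign

variable {P : Finset (Sphere n)}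

lemma energy_eq_mul_card_sq (hP : IsFDesign f c P)
    (hf : ∀ t ∈ Set.Icc (-1 : ℝ) 1,
      Tendsto (fun N => ∑ k ∈ Finset.range N, c k * gegenbauer n k t) atTop (𝓝 (f t)))
    (x : ι ≃ {p // p ∈ P}) :
    energy (fun p q => f (dot p q)) (fun i => (x i : Sphere n))
      = c 0 * (Fintype.card ι : ℝ) ^ 2 := by
  have hvanish : ∀ k, k ≠ 0 →
      c k * energy (fun p q => gegenbauer n k (dot p q)) (fun i => (x i : Sphere n)) = 0 := by
    intro k hk
    refine mul_eq_zero.2 (or_iff_not_imp_left.2 fun hck => ?_)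
    exact (energy_comp_equiv _ x _).trans
      ((moment_eq_energy k P).symm.trans (hP.1 k (Nat.pos_of_ne_zero hk) hck))
  rw [← energy_gegenbauer_zero fun i => (x i : Sphere n)]
  exact tendsto_nhds_unique (tendsto_sum_mul_energy (fun p q => hf _ (dot_mem_Icc p q)) _)
    (hasSum_single 0 hvanish).tendsto_sum_nat

lemma apply_dot_eq_zero (hP : IsFDesign f c P) {p q : Sphere n} (hp : p ∈ P) (hq : q ∈ P)
    (hpq : p ≠ q) : f (dot p q) = 0 :=
  (hP.2 ⟨p, hp, q, hq, hpq, rfl⟩).2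

lemma pairValues_eq_replicate {m : ℕ} (hP : IsFDesign f c P) (x : Fin m ≃ {p // p ∈ P}) :
    pairValues (fun p q => -f (dot p q)) (fun i => (x i : Sphere n))
      = Multiset.replicate
          (pairValues (fun p q => -f (dot p q)) (fun i => (x i : Sphere n))).card 0 := by
  refine Multiset.eq_replicate_card.2 fun b hb => ?_
  obtain ⟨⟨i, j⟩, hij, rfl⟩ := Multiset.mem_map.1 hb
  have hne : (x i : Sphere n) ≠ x j := fun h =>
    (Finset.mem_filter.1 hij).2.ne (x.injective (Subtype.ext h))
  exact neg_eq_zero.2 (hP.apply_dot_eq_zero (x i).2 (x j).2 hne)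

end IsFDesign

theorem mainTheorem4_general (hn : 2 ≤ n)
    (hf : ∀ t ∈ Set.Icc (-1 : ℝ) 1,
      Tendsto (fun N => ∑ k ∈ Finset.range N, c k * gegenbauer n k t) atTop (𝓝 (f t)))
    (hc : ∀ k, 0 < k → 0 ≤ c k) {P : Finset (Sphere n)} (hP : IsFDesign f c P) {m : ℕ}
    (x : Fin m ≃ {p // p ∈ P}) (y : Fin m → Sphere n) :
    Majorizes (pairValues (fun p q => -f (dot p q)) fun i => (x i : Sphere n))
      (pairValues (fun p q => -f (dot p q)) y) := by
  have hx_zero := hP.pairValues_eq_replicate x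
  have hx_energy := hP.energy_eq_mul_card_sq hf x
  have hy_energy := mul_card_sq_le_energy hn hf hc y
  rw [energy_dot, hx_zero, Multiset.sum_replicate, nsmul_zero] at hx_energy
  rw [energy_dot] at hy_energy
  rw [hx_zero, card_pairValues_congr _ _ y]
  refine majorizes_replicate ?_
  linarith

end Spherical

end SphericalFDesign

theorem mainTheorem4 (n : ℕ) (hn : 2 ≤ n) (f : ℝ → ℝ) (c : ℕ → ℝ)
    (hf : SphericalFDesign.HasGegenbauerSeries n f c) (hc : ∀ k : ℕ, 0 ≤ c k)
    (P : Finset (SphericalFDesign.Sphere n)) (hP : SphericalFDesign.IsFDesign f c P) :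
    P ∈ SphericalFDesign.mSets (SphericalFDesign.Sphere n)
      (fun x y => - f (SphericalFDesign.dot x y)) P.card :=
  ⟨rfl, fun x y => Or.inl <| SphericalFDesign.mainTheorem4_general hn (fun _ ht => hf.tendsto_at ht)
    (fun k _ => hc k) hP x y⟩
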